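/- Let $\mathbb K=\mathbb R$ or $\mathbb K=\mathbb C$, let $X\subset\mathbb K^n$ and $Y\subset\mathbb K^m$ be open, and write $J_n=\mathbb R\times\mathbb K^n\times \mathrm{Herm}_n(\mathbb K)$ and $J(X)=X\times J_n$, where $\mathrm{Herm}_n(\mathbb K)$ denotes the real symmetric (resp. complex hermitian) $n\times n$ matrices. A set $F\subset J(X)$, with fibres $F_x\subset J_n$ for $x\in X$, is a *primitive subequation* if it is closed in $J(X)$ and $(r,p,A)\in F_x$ implies $(r,p,A+P)\in F_x$ for all positive semidefinite $P\in\mathrm{Herm}_n(\mathbb K)$. It is *constant coefficient* if $F_x$ does not depend on $x$. *Subharmonicity.* Let $U\subset X$ be open. If $\mathbb K=\mathbb R$, an upper semicontinuous $f:U\to\mathbb R\cup\{-\infty\}$ is *$F$-subharmonic* if $(f(x),p,A)\in F_x$ whenever $x\in U$, $f(x)\ne-\infty$, and $(p,A)\in\mathbb R^n\times\mathrm{Herm}_n(\mathbb R)$ satisfies $f(y)\le f(x)+p\cdot(y-x)+\tfrac12(y-x)^tA(y-x)$ for all $y$ sufficiently near $x$. If $\mathbb K=\mathbb C$, identify $\mathbb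 C^n$ with $\mathbb R^{2n}$ by $a+ib\leftrightarrow(a,b)$; then $f$ is *$F$-subharmonic* if the same condition holds for all $(p,A)\in\mathbb R^{2n}\times\mathrm{Herm}_{2n}(\mathbb R)$, with the conclusion $(f(x),p,A_{\mathbb C})\in F_x$, where $p$ is regarded as an element of $\mathbb C^n$ and, for $\mathbb J=\begin{pmatrix}0&-I\\ I&0\end{pmatrix}$, the matrix $A_{\mathbb C}=\tfrac12(A-\mathbb JA\mathbb J)$, which commutes with $\mathbb J$, is regarded as a hermitian $n\times n$ matrix via $\begin{pmatrix}a&-b\\ b&a\end{pmatrix}\leftrightarrow a+ib$. *Products.* For $F\subset J(X)$ and $G\subset J(Y)$ the set $F\#G\subset J(X\times Y)$ consists of all $\bigl((x,y),r,\binom{p_1}{p_2},\begin{pmatrix}B&C\\ C^*&D\end{pmatrix}\bigr)$ such that $(r,\;p_1+\Gamma^*p_2,\;B+C\Gamma+\Gamma^*C^*+\Gamma^*D\Gamma)\in F_x$ for all $\mathbb K$-linear maps $\Gamma:\mathbb K^n\to\mathbb K^m$, and $(r,p_2,D)\in G_y$. (When $\mathbb K=\mathbb R$, $^*$ is the transpose.)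 **Proposition.** Let $F\subset J(X)$ and $G\subset J(Y)$ be constant coefficient primitive subequations, let $\Omega\subset X\times Y$ be open, and let $f:\Omega\to\mathbb R\cup\{-\infty\}$ be upper semicontinuous. Then the following are equivalent: 1. $f$ is $F\#G$-subharmonic on $\Omega$; 2. for every $y_0\in\mathbb K^m$ and every $\mathbb K$-linear $\Gamma:\mathbb K^n\to\mathbb K^m$ the function $x\mapsto f(x,y_0+\Gamma x)$ is $F$-subharmonic on the open set $\{x:(x,y_0+\Gamma x)\in\Omega\}$, and for every $x_0\in X$ the function $y\mapsto f(x_0,y)$ is $G$-subharmonic on the open set $\{y:(x_0,y)\in\Omega\}$. This holds both for $\mathbb K=\mathbb R$ and for $\mathbb K=\mathbb C$. -/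

import Mathlib

open Matrix Topology
open scoped ComplexOrder

/-! ### Jets and primitive subequations, over `𝕜 = ℝ` and `𝕜 = ℂ` simultaneously

Points of `𝕜ⁿ` are functions `ι → 𝕜` (only the topology of this space is used, so the choice of norm
is irrelevant), and `𝕜ⁿ⁺ᵐ = 𝕜ⁿ × 𝕜ᵐ` is `ι ⊕ κ → 𝕜`. -/

/-- Hermitian matrices; for `𝕜 = ℝ` these are the real symmetric matrices. -/
abbrev HermMat (𝕜 : Type*) [RCLike 𝕜] (ι : Type*) := {A : Matrix ι ι 𝕜 // A.IsHermitian}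

/-- The fibre `J²_n = ℝ × 𝕜ⁿ × Herm_n` of the bundle of 2-jets. -/
abbrev Jet (𝕜 : Type*) [RCLike 𝕜] (ι : Type*) := ℝ × (ι → 𝕜) × HermMat 𝕜 ι

/-- The bundle of 2-jets `J²(X) = X × J²_n` over `X ⊆ 𝕜ⁿ`: for `𝕜 = ℝ` it is
`X × ℝ × ℝⁿ × Sym_n`, and for `𝕜 = ℂ` it is `J^{2,ℂ}(X) = X × ℝ × ℂⁿ × Herm_n`. -/
abbrev JetBundle {𝕜 : Type*} [RCLike 𝕜] {ι : Type*} (X : Set (ι → 𝕜)) := X × Jet 𝕜 ι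

/-- The fibre `F_x` of `F ⊆ J²(X)`. -/
def jetFibre {𝕜 : Type*} [RCLike 𝕜] {ι : Type*} {X : Set (ι → 𝕜)} (F : Set (JetBundle X)) (x : X) :
    Set (Jet 𝕜 ι) :=
  {α | (x, α) ∈ F}

/-- (Real or complex) primitive subequations: closed in `J²(X)`, and stable under adding a
semipositive matrix to the Hessian part. -/
structure IsPrimitiveSubequation {𝕜 : Type*} [RCLike 𝕜] {ι : Type*} [Fintype ι] {X : Set (ι → 𝕜)}
    (F : Set (JetBundle X)) : Prop where
  closed : IsClosed F
  positivity : ∀ (x : X) (r : ℝ) (p : ι → 𝕜) (A : HermMat 𝕜 ι) (P : Matrix ι ι 𝕜)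
    (hP : P.PosSemidef), (r, p, A) ∈ jetFibre F x →
      (r, p, ⟨A.1 + P, A.2.add hP.isHermitian⟩) ∈ jetFibre F x

/-- `F` is constant coefficient: `F_x` does not depend on `x`. -/
def IsConstantCoefficient {𝕜 : Type*} [RCLike 𝕜] {ι : Type*} {X : Set (ι → 𝕜)}
    (F : Set (JetBundle X)) : Prop :=
  ∀ (x x' : X) (α : Jet 𝕜 ι), α ∈ jetFibre F x ↔ α ∈ jetFibre F x'

/-! ### Products -/

/-- The pullback `i_Γ^*` of jets under `x ↦ (x, Γ x)`, where the Hessian part is written in blocks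
`(B, C; C*, D)`. For `𝕜 = ℝ` the conjugate transpose is the transpose. -/
def pullNonvertical {𝕜 : Type*} [RCLike 𝕜] {ι κ : Type*} [Fintype ι] [Fintype κ]
    (Γ : Matrix κ ι 𝕜) (α : Jet 𝕜 (ι ⊕ κ)) : Jet 𝕜 ι :=
  (α.1,
   (fun i => α.2.1 (Sum.inl i)) + Γᴴ *ᵥ (fun k => α.2.1 (Sum.inr k)),
   ⟨α.2.2.1.toBlocks₁₁ + α.2.2.1.toBlocks₁₂ * Γ + Γᴴ * (α.2.2.1.toBlocks₁₂)ᴴ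
      + Γᴴ * α.2.2.1.toBlocks₂₂ * Γ, by
    have h := α.2.2.2
    rw [← fromBlocks_toBlocks α.2.2.1, isHermitian_fromBlocks_iff] at h
    obtain ⟨h1, -, -, h2⟩ := h
    unfold Matrix.IsHermitian
    simp only [conjTranspose_add, conjTranspose_mul, conjTranspose_conjTranspose, h1.eq, h2.eq,
      Matrix.mul_assoc]
    abel⟩)

/-- The pullback `j^*` of jets under `y ↦ (0, y)`. -/
def pullVertical {𝕜 : Type*} [RCLike 𝕜] {ι κ : Type*} (α : Jet 𝕜 (ι ⊕ κ)) : Jet 𝕜 κ :=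
  (α.1, fun k => α.2.1 (Sum.inr k), ⟨α.2.2.1.toBlocks₂₂, by
    have h := α.2.2.2
    rw [← fromBlocks_toBlocks α.2.2.1, isHermitian_fromBlocks_iff] at h
    exact h.2.2.2⟩)

/-- `X × Y` as a subset of `𝕜ⁿ⁺ᵐ`. -/
def prodDomain {𝕜 : Type*} {ι κ : Type*} (X : Set (ι → 𝕜)) (Y : Set (κ → 𝕜)) :
    Set (ι ⊕ κ → 𝕜) :=
  {z | (fun i => z (Sum.inl i)) ∈ X ∧ (fun k => z (Sum.inr k)) ∈ Y}

/-- The product `F # G ⊆ J²(X × Y)`; for `𝕜 = ℂ` this is `F #_ℂ G`, as `Γ` runs through the complex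
linear maps. -/
def prodSubequation {𝕜 : Type*} [RCLike 𝕜] {ι κ : Type*} [Fintype ι] [Fintype κ]
    {X : Set (ι → 𝕜)} {Y : Set (κ → 𝕜)} (F : Set (JetBundle X)) (G : Set (JetBundle Y)) :
    Set (JetBundle (prodDomain X Y)) :=
  {a | ∀ Γ : Matrix κ ι 𝕜,
    pullNonvertical Γ a.2 ∈ jetFibre F ⟨_, a.1.2.1⟩ ∧ pullVertical a.2 ∈ jetFibre G ⟨_, a.1.2.2⟩}

/-! ### `F`-subharmonic functions, real case

Functions with values in `ℝ ∪ {-∞}` are functions to `WithBot ℝ`. -/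

/-- `(p, A)` is an upper contact jet of `f` at `x`. -/
def IsUpperContactJet {ι : Type*} [Fintype ι] {U : Set (ι → ℝ)} (f : U → WithBot ℝ) (x : U)
    (p : ι → ℝ) (A : HermMat ℝ ι) : Prop :=
  f x ≠ ⊥ ∧ ∀ᶠ y : U in 𝓝 x,
    f y ≤ f x + ((p ⬝ᵥ (y.1 - x.1) + 1 / 2 * ((y.1 - x.1) ⬝ᵥ (A.1 *ᵥ (y.1 - x.1))) : ℝ) : WithBot ℝ)

/-- For `F ⊆ J²(X)` and `U ⊆ X`, the function `f : U → ℝ ∪ {-∞}` is `F`-subharmonic (on `U`). -/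
def IsSubharmonic {ι : Type*} [Fintype ι] {X : Set (ι → ℝ)} (F : Set (JetBundle X))
    {U : Set (ι → ℝ)} (hU : U ⊆ X) (f : U → WithBot ℝ) : Prop :=
  UpperSemicontinuous f ∧
    ∀ (x : U) (r : ℝ) (p : ι → ℝ) (A : HermMat ℝ ι),
      f x = (r : WithBot ℝ) → IsUpperContactJet f x p A →
        (r, p, A) ∈ jetFibre F ⟨x.1, hU x.2⟩

/-! ### `F`-subharmonic functions, complex case -/

/-- The identification `ℝ²ⁿ ≃ ℂⁿ`, `(a, b) ↦ a + i b`. -/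
def toComplexVec {ι : Type*} (v : ι ⊕ ι → ℝ) : ι → ℂ := fun i => ⟨v (Sum.inl i), v (Sum.inr i)⟩

/-- The part `A_ℂ = (A - 𝕁 A 𝕁) / 2` of a real `2n × 2n` matrix that commutes with
`𝕁 = (0, -1; 1, 0)`. -/
noncomputable def complexPart {ι : Type*} [Fintype ι] [DecidableEq ι]
    (A : Matrix (ι ⊕ ι) (ι ⊕ ι) ℝ) : Matrix (ι ⊕ ι) (ι ⊕ ι) ℝ :=
  (1 / 2 : ℝ) • (A - Matrix.J ι ℝ * A * Matrix.J ι ℝ)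

/-- The complex matrix `a + i b` of a real block matrix `(a, -b; b, a)` commuting with `𝕁`. -/
noncomputable def hatMat {ι : Type*} (A : Matrix (ι ⊕ ι) (ι ⊕ ι) ℝ) : Matrix ι ι ℂ :=
  Matrix.of fun i j => ⟨A (Sum.inl i) (Sum.inl j), A (Sum.inr i) (Sum.inl j)⟩

theorem hatMat_complexPart_apply {ι : Type*} [Fintype ι] [DecidableEq ι]
    (A : Matrix (ι ⊕ ι) (ι ⊕ ι) ℝ) (i j : ι) :
    hatMat (complexPart A) i j =
      ⟨1 / 2 * (A (Sum.inl i) (Sum.inl j) + A (Sum.inr i) (Sum.inr j)),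
        1 / 2 * (A (Sum.inr i) (Sum.inl j) - A (Sum.inl i) (Sum.inr j))⟩ := by
  have h : Matrix.J ι ℝ * A * Matrix.J ι ℝ =
      fromBlocks (-A.toBlocks₂₂) A.toBlocks₂₁ A.toBlocks₁₂ (-A.toBlocks₁₁) := by
    conv_lhs => rw [← fromBlocks_toBlocks A]
    simp [Matrix.J, fromBlocks_multiply]
  simp [hatMat, complexPart, h, toBlocks₂₂, toBlocks₁₂]

theorem hatMat_complexPart_isHermitian {ι : Type*} [Fintype ι] [DecidableEq ι]
    (A : HermMat ℝ (ι ⊕ ι)) : (hatMat (complexPart A.1)).IsHermitian := by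
  ext i j
  have h : ∀ a b, A.1 a b = A.1 b a := fun a b => by simpa using (A.2.apply a b).symm
  rw [conjTranspose_apply, hatMat_complexPart_apply, hatMat_complexPart_apply]
  apply Complex.ext
  · simp [h (Sum.inl j) (Sum.inl i), h (Sum.inr j) (Sum.inr i)]
  · simp [h (Sum.inr j) (Sum.inl i), h (Sum.inl j) (Sum.inr i)]
    ring

/-- The subset of `J²(X)`, `X ⊆ ℝ²ⁿ`, corresponding to `F ⊆ J^{2,ℂ}(X)`, `X ⊆ ℂⁿ`: the real 2-jet
`(x, r, p, A)` belongs to it if and only if `(x, r, p, A_ℂ)` belongs to `F`. -/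
def realModel {ι : Type*} [Fintype ι] [DecidableEq ι] {X : Set (ι → ℂ)} (F : Set (JetBundle X)) :
    Set (JetBundle (toComplexVec ⁻¹' X)) :=
  {a | (a.2.1, toComplexVec a.2.2.1,
      (⟨hatMat (complexPart a.2.2.2.1), hatMat_complexPart_isHermitian a.2.2.2⟩ : HermMat ℂ ι)) ∈
        jetFibre F ⟨toComplexVec a.1.1, a.1.2⟩}

/-- For `F ⊆ J^{2,ℂ}(X)` and `U ⊆ X ⊆ ℂⁿ`, the function `f : U → ℝ ∪ {-∞}` is `F`-subharmonic: it is
so as a function on a subset of `ℝ²ⁿ`. -/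
def IsComplexSubharmonic {ι : Type*} [Fintype ι] [DecidableEq ι] {X : Set (ι → ℂ)}
    (F : Set (JetBundle X)) {U : Set (ι → ℂ)} (hU : U ⊆ X) (f : U → WithBot ℝ) : Prop :=
  IsSubharmonic (realModel F) (Set.preimage_mono hU : toComplexVec ⁻¹' U ⊆ toComplexVec ⁻¹' X)
    (fun v => f ⟨toComplexVec v.1, v.2⟩)

/-! ### Slices -/

/-- The non-vertical slice `i_{y₀,Γ} : x ↦ (x, y₀ + Γ x)`. -/
def nonverticalSlice {𝕜 : Type*} [RCLike 𝕜] {ι κ : Type*} [Fintype ι] (y₀ : κ → 𝕜)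
    (Γ : Matrix κ ι 𝕜) (x : ι → 𝕜) : ι ⊕ κ → 𝕜 :=
  Sum.elim x (y₀ + Γ *ᵥ x)

/-- The vertical slice `j_{x₀} : y ↦ (x₀, y)`. -/
def verticalSlice {𝕜 : Type*} {ι κ : Type*} (x₀ : ι → 𝕜) (y : κ → 𝕜) : ι ⊕ κ → 𝕜 :=
  Sum.elim x₀ y

/-- The pullback `s^* f` of a function `f` on `Ω` under `s`, defined on `s⁻¹(Ω)`. -/
def pullbackFun {α β : Type*} {Ω : Set β} (s : α → β) (f : Ω → WithBot ℝ) : (s ⁻¹' Ω) → WithBot ℝ :=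
  fun x => f ⟨s x.1, x.2⟩

theorem nonverticalSlice_preimage_subset {𝕜 : Type*} [RCLike 𝕜] {ι κ : Type*} [Fintype ι]
    {X : Set (ι → 𝕜)} {Y : Set (κ → 𝕜)} {Ω : Set (ι ⊕ κ → 𝕜)} (hΩ : Ω ⊆ prodDomain X Y)
    (y₀ : κ → 𝕜) (Γ : Matrix κ ι 𝕜) : nonverticalSlice y₀ Γ ⁻¹' Ω ⊆ X :=
  fun _ hx => (hΩ hx).1

theorem verticalSlice_preimage_subset {𝕜 : Type*} {ι κ : Type*}
    {X : Set (ι → 𝕜)} {Y : Set (κ → 𝕜)} {Ω : Set (ι ⊕ κ → 𝕜)} (hΩ : Ω ⊆ prodDomain X Y)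
    (x₀ : ι → 𝕜) : verticalSlice x₀ ⁻¹' Ω ⊆ Y :=
  fun _ hy => (hΩ hy).2

/-! Both kinds of slices are affine embeddings `x ↦ c + L x` with a left inverse `R` of the linear
part `L`, and the two conditions defining `F # G` say that the pullbacks of a jet under these
embeddings lie in `F` and `G`.

From slices to `f`: substituting the embedding into a contact inequality pulls a contact jet of `f`
at `z` back to one of the slice through `z` (`IsUpperContactJet.comp_affine`), and slices of every
slope `Γ` pass through `z`.

From `f` to slices, a contact jet of the slice need not extend to one of `f`, so it is approximated.
After adding `δ • 1` to `A` the contact is strict. Extend the test polynomial by `R` and add a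
penalty `k Θ`, with `Θ` half the squared length of `(1 - L R)(z - z₀)`. The maxima of `f` minus this
function tend to `z₀` as `k → ∞`, with values tending to `f z₀` (`exists_penalized_maxima`), and
they give contact jets of `f`. Since `(1 - L R) L = 0`, the penalty vanishes under pullback: the
pulled-back jets have Hessian `A + δ • 1` and converge. Closedness yields the limit jet, and then `δ
→ 0` (`IsUpperContactJet.mem_of_forall_pullJet_mem`). Constant coefficients put the approximating
jets, based at different points, into one fibre.

The complex case uses the same affine lemmas on `ℝ²ⁿ`, because passing from real to complex jets
commutes with pullback by complex linear maps (`complexJet_pullJet`). -/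

/-! ### Maxima of upper semicontinuous functions under a penalty -/

open Filter in
theorem UpperSemicontinuous.add_coe_continuous {Z : Type*} [TopologicalSpace Z]
    {f : Z → WithBot ℝ} (hf : UpperSemicontinuous f) {a : Z → ℝ} (ha : Continuous a) :
    UpperSemicontinuous fun z => f z + (a z : WithBot ℝ) := by
  intro z y hy
  change f z + (a z : WithBot ℝ) < y at hy
  induction y using WithBot.recBotCoe with
  | bot => exact absurd hy not_lt_bot
  | coe y =>
    obtain ⟨t, ht, hty⟩ : ∃ t : ℝ, f z < t ∧ t < y - a z := by
      cases h : f z using WithBot.recBotCoe with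
      | bot => exact ⟨y - a z - 1, WithBot.bot_lt_coe _, by linarith⟩
      | coe s =>
        rw [h] at hy
        have : s + a z < y := by exact_mod_cast hy
        exact ⟨(s + (y - a z)) / 2, by rw [WithBot.coe_lt_coe]; linarith, by linarith⟩
    have h1 : ∀ᶠ w in 𝓝 z, a w < y - t := ha.continuousAt.eventually_lt_const (by linarith)
    filter_upwards [hf z t ht, h1] with w hw haw
    have hw' : f w < t := hw
    change f w + (a w : WithBot ℝ) < y
    cases h : f w using WithBot.recBotCoe with
    | bot => rw [WithBot.bot_add]; exact WithBot.bot_lt_coe _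
    | coe s =>
      rw [h, WithBot.coe_lt_coe] at hw'
      have : s + a w < y := by linarith
      exact_mod_cast this

open Filter in
/-- Maxima of `f - φ - k Θ` on a compact set concentrate, as `k → ∞`, at the strict maximum of
`f - φ` on the zero set of `Θ`. -/
theorem exists_penalized_maxima {Z : Type*} [TopologicalSpace Z] [FirstCountableTopology Z]
    {S : Set Z} (hS : IsCompact S) {f : Z → WithBot ℝ} (hf : UpperSemicontinuous f) {φ Θ : Z → ℝ}
    (hφ : Continuous φ) (hΘ : Continuous Θ) (hΘ0 : ∀ z, 0 ≤ Θ z) {z₀ : Z} (hz₀ : z₀ ∈ S) {r : ℝ}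
    (hr : f z₀ = r) (hφz₀ : φ z₀ = 0) (hΘz₀ : Θ z₀ = 0)
    (hstrict : ∀ z ∈ S, Θ z = 0 → ((r + φ z : ℝ) : WithBot ℝ) ≤ f z → z = z₀) :
    ∃ (k : ℕ → ℕ) (z : ℕ → Z) (t : ℕ → ℝ), (∀ j, z j ∈ S) ∧ (∀ j, f (z j) = t j) ∧
      (∀ j, ∀ y ∈ S,
        f y ≤ ((t j + (φ y + k j * Θ y - (φ (z j) + k j * Θ (z j))) : ℝ) : WithBot ℝ)) ∧
      Tendsto z atTop (𝓝 z₀) ∧ Tendsto t atTop (𝓝 r) := by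
  have hmax : ∀ k : ℕ, ∃ z ∈ S, ∃ t : ℝ, f z = t ∧ ∀ y ∈ S,
      f y ≤ ((t + (φ y + k * Θ y - (φ z + k * Θ z)) : ℝ) : WithBot ℝ) := by
    intro k
    have hc : Continuous fun z => -(φ z + k * Θ z) := by fun_prop
    obtain ⟨z, hz, hzmax⟩ := UpperSemicontinuousOn.exists_isMaxOn ⟨z₀, hz₀⟩ hS
      ((hf.add_coe_continuous hc).upperSemicontinuousOn S)
    have key : ∀ y ∈ S, f y + ((-(φ y + k * Θ y) : ℝ) : WithBot ℝ) ≤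
      f z + ((-(φ z + k * Θ z) : ℝ) : WithBot ℝ) := fun y hy => hzmax hy
    refine ⟨z, hz, ?_⟩
    cases h : f z using WithBot.recBotCoe with
    -- The maximum is finite because the value at `z₀` is.
    | bot =>
      have := key z₀ hz₀
      rw [h, hr, WithBot.bot_add, ← WithBot.coe_add] at this
      exact absurd this (by simp)
    | coe t =>
      refine ⟨t, rfl, fun y hy => ?_⟩
      have := key y hy
      cases h' : f y using WithBot.recBotCoe with
      | bot => exact bot_le
      | coe s =>
        rw [h, h', ← WithBot.coe_add, ← WithBot.coe_add, WithBot.coe_le_coe] at this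
        rw [WithBot.coe_le_coe]
        linarith
  choose z hzS t ht hzt using hmax
  have hrt : ∀ k : ℕ, r + (φ (z k) + k * Θ (z k)) ≤ t k := by
    intro k
    have := hzt k z₀ hz₀
    rw [hr, hφz₀, hΘz₀, WithBot.coe_le_coe] at this
    linarith
  -- Here `z 0` is the maximizer without penalty, not `z₀`. Its maximality bounds `t k - φ (z k)`
  -- independently of `k`, which forces `Θ (z k) → 0`.
  have hbd : ∀ k : ℕ, k * Θ (z k) ≤ t 0 - φ (z 0) - r := by
    intro k
    have h1 := hzt 0 (z k) (hzS k)
    rw [ht k, WithBot.coe_le_coe] at h1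
    have h2 := hrt k
    simp only [CharP.cast_eq_zero, zero_mul, add_zero] at h1
    linarith
  obtain ⟨z', hz', σ, hσ, hlim⟩ := hS.tendsto_subseq hzS
  have hσ' : Tendsto (fun j => (σ j : ℝ)) atTop atTop :=
    tendsto_natCast_atTop_atTop.comp hσ.tendsto_atTop
  have hΘz' : Θ z' = 0 := by
    have h1 : Tendsto (fun j => Θ (z (σ j))) atTop (𝓝 (Θ z')) := (hΘ.tendsto z').comp hlim
    have h2 : Tendsto (fun j => (t 0 - φ (z 0) - r) / (σ j : ℝ)) atTop (𝓝 0) :=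
      tendsto_const_nhds.div_atTop hσ'
    refine le_antisymm (le_of_tendsto_of_tendsto h1 h2 ?_) (hΘ0 z')
    filter_upwards [hσ'.eventually_gt_atTop 0] with j hj
    rw [le_div_iff₀ hj, mul_comm]
    exact hbd _
  have hφlim : Tendsto (fun j => r + φ (z (σ j))) atTop (𝓝 (r + φ z')) :=
    ((hφ.tendsto z').comp hlim).const_add r
  have hle : ∀ j, r + φ (z (σ j)) ≤ t (σ j) := fun j => by
    have := hrt (σ j)
    have := mul_nonneg (Nat.cast_nonneg (α := ℝ) (σ j)) (hΘ0 (z (σ j)))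
    linarith
  have hlt : ∀ y : ℝ, f z' < y → ∀ᶠ j in atTop, t (σ j) < y := by
    intro y hy
    filter_upwards [hlim.eventually (hf z' y hy)] with j hj
    have hj' : f (z (σ j)) < y := hj
    rwa [ht, WithBot.coe_lt_coe] at hj'
  -- Upper semicontinuity carries `r + φ (z k) ≤ f (z k)` to the limit point, where strictness
  -- applies.
  have hzz : z' = z₀ := by
    refine hstrict z' hz' hΘz' ?_
    by_contra hcon
    rw [not_le] at hcon
    obtain ⟨y, hy, hyr⟩ : ∃ y : ℝ, f z' < y ∧ y < r + φ z' := by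
      cases h : f z' using WithBot.recBotCoe with
      | bot => exact ⟨r + φ z' - 1, WithBot.bot_lt_coe _, by linarith⟩
      | coe s =>
        rw [h, WithBot.coe_lt_coe] at hcon
        exact ⟨(s + (r + φ z')) / 2, by rw [WithBot.coe_lt_coe]; linarith, by linarith⟩
    obtain ⟨j, hj1, hj2⟩ := ((hlt y hy).and (hφlim.eventually_const_lt hyr)).exists
    linarith [hle j]
  subst hzz
  refine ⟨σ, fun j => z (σ j), fun j => t (σ j), fun j => hzS _, fun j => ht _, fun j => hzt _,
    hlim, ?_⟩
  rw [hφz₀, add_zero] at hφlim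
  refine tendsto_order.2 ⟨fun a ha => ?_, fun a ha => hlt a ?_⟩
  · filter_upwards [hφlim.eventually_const_lt ha] with j hj using hj.trans_le (hle j)
  · rw [hr, WithBot.coe_lt_coe]; exact ha

/-! ### Jets and quadratic polynomials under affine maps -/

/-- The pullback of jets under an affine map with linear part `L`. -/
def pullJet {𝕜 : Type*} [RCLike 𝕜] {ι ν : Type*} [Fintype ν] (L : Matrix ν ι 𝕜)
    (α : Jet 𝕜 ν) : Jet 𝕜 ι :=
  (α.1, Lᴴ *ᵥ α.2.1, ⟨Lᴴ * α.2.2.1 * L, isHermitian_conjTranspose_mul_mul L α.2.2.2⟩)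

/-- The quadratic polynomial with gradient `p` and Hessian `A` at the origin. -/
noncomputable def quadPoly {ι : Type*} [Fintype ι] (p : ι → ℝ) (A : Matrix ι ι ℝ) (w : ι → ℝ) : ℝ :=
  p ⬝ᵥ w + 1 / 2 * (w ⬝ᵥ (A *ᵥ w))

theorem continuous_quadPoly {ι : Type*} [Fintype ι] (p : ι → ℝ) (A : Matrix ι ι ℝ) :
    Continuous (quadPoly p A) := by
  unfold quadPoly
  fun_prop

theorem quadPoly_mulVec {ι ν : Type*} [Fintype ι] [Fintype ν] (p : ν → ℝ)
    (A : Matrix ν ν ℝ) (L : Matrix ν ι ℝ) (w : ι → ℝ) :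
    quadPoly p A (L *ᵥ w) = quadPoly (Lᴴ *ᵥ p) (Lᴴ * A * L) w := by
  have h : ∀ u : ν → ℝ, u ⬝ᵥ (L *ᵥ w) = (Lᴴ *ᵥ u) ⬝ᵥ w := fun u => by
    rw [dotProduct_mulVec, conjTranspose_eq_transpose_of_trivial, mulVec_transpose]
  rw [quadPoly, quadPoly, h, dotProduct_comm (L *ᵥ w), h, dotProduct_comm w]
  simp only [mulVec_mulVec, Matrix.mul_assoc]

/-- Taylor expansion at `w`: it turns a test polynomial centred at `z₀` into a contact jet at a
nearby maximum point. -/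
theorem quadPoly_sub {ι : Type*} [Fintype ι] (p : ι → ℝ) {A : Matrix ι ι ℝ} (hA : A.IsHermitian)
    (v w : ι → ℝ) : quadPoly p A v - quadPoly p A w = quadPoly (p + A *ᵥ w) A (v - w) := by
  have h : v ⬝ᵥ (A *ᵥ w) = w ⬝ᵥ (A *ᵥ v) := by
    rw [dotProduct_mulVec, ← mulVec_transpose, ← conjTranspose_eq_transpose_of_trivial, hA.eq,
      dotProduct_comm]
  simp only [quadPoly, mulVec_sub, dotProduct_sub, sub_dotProduct, add_dotProduct,
    dotProduct_comm (A *ᵥ w), h]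
  ring

theorem IsUpperContactJet.comp_affine {ι ν : Type*} [Fintype ι] [Fintype ν] {U : Set (ν → ℝ)}
    {V : Set (ι → ℝ)} {f : U → WithBot ℝ} {g : V → WithBot ℝ} (L : Matrix ν ι ℝ) (c : ν → ℝ)
    (hVU : ∀ x ∈ V, c + L *ᵥ x ∈ U) (hg : ∀ x : V, g x = f ⟨c + L *ᵥ x.1, hVU _ x.2⟩) {x : V}
    {α : Jet ℝ ν} (h : IsUpperContactJet f ⟨c + L *ᵥ x.1, hVU _ x.2⟩ α.2.1 α.2.2) :
    IsUpperContactJet g x (pullJet L α).2.1 (pullJet L α).2.2 := by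
  refine ⟨by rw [hg]; exact h.1, ?_⟩
  have hc : Continuous fun y : V => (⟨c + L *ᵥ y.1, hVU _ y.2⟩ : U) := by fun_prop
  filter_upwards [(hc.tendsto x).eventually h.2] with y hy
  rw [hg, hg]
  refine hy.trans_eq ?_
  congr 2
  have := quadPoly_mulVec α.2.1 α.2.2.1 L (y.1 - x.1)
  rw [mulVec_sub] at this
  rw [add_sub_add_left_eq_sub]
  exact this

/-! ### Subharmonicity and restriction to affine subspaces -/

open Filter in
/-- Restriction to an affine subspace: if the contact jets of `f` pull back into the closed set `K`,
then `K` contains the contact jets of the restriction of `f`. -/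
theorem IsUpperContactJet.mem_of_forall_pullJet_mem {ι ν : Type*} [Fintype ι] [Fintype ν]
    [DecidableEq ι] [DecidableEq ν] {U : Set (ν → ℝ)} {V : Set (ι → ℝ)} {f : U → WithBot ℝ}
    {g : V → WithBot ℝ} (hU : IsOpen U) (hf : UpperSemicontinuous f) {L : Matrix ν ι ℝ}
    {R : Matrix ι ν ℝ} (hRL : R * L = 1) (c : ν → ℝ) (hVU : ∀ x, x ∈ V ↔ c + L *ᵥ x ∈ U)
    (hg : ∀ x : V, g x = f ⟨c + L *ᵥ x.1, (hVU _).1 x.2⟩) {K : Set (Jet ℝ ι)} (hK : IsClosed K)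
    (hfK : ∀ (z : U) (α : Jet ℝ ν), f z = α.1 → IsUpperContactJet f z α.2.1 α.2.2 →
      pullJet L α ∈ K)
    {x : V} {r : ℝ} {p : ι → ℝ} {A : HermMat ℝ ι} (hr : g x = r) (hc : IsUpperContactJet g x p A) :
    (r, p, A) ∈ K := by
  have hherm : ∀ δ : ℝ, (A.1 + δ • (1 : Matrix ι ι ℝ)).IsHermitian := fun δ =>
    A.2.add (by simp [IsHermitian])
  suffices h : ∀ δ : ℝ, 0 < δ → (r, p, (⟨A.1 + δ • 1, hherm δ⟩ : HermMat ℝ ι)) ∈ K by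
    have hcont : Continuous fun δ : ℝ => (r, p, (⟨A.1 + δ • 1, hherm δ⟩ : HermMat ℝ ι)) := by
      fun_prop
    have h0 := (hcont.tendsto 0).mono_left (nhdsWithin_le_nhds (s := Set.Ioi 0))
    have := hK.mem_of_tendsto h0 (eventually_nhdsWithin_of_forall fun δ hδ => h δ hδ)
    simpa using this
  intro δ hδ
  set A' : Matrix ι ι ℝ := A.1 + δ • 1 with hA'
  set z₀ : U := ⟨c + L *ᵥ x.1, (hVU _).1 x.2⟩ with hz₀
  -- A projection along the image of `L`; its kernel is that image, so `Θ` vanishes exactly on the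
  -- slice.
  set π : Matrix ν ν ℝ := 1 - L * R with hπ
  have hπL : π * L = 0 := by
    rw [hπ, Matrix.sub_mul, Matrix.mul_assoc, hRL]; simp
  set φ : U → ℝ := fun z => quadPoly p A' (R *ᵥ (z.1 - z₀.1)) with hφ
  set Θ : U → ℝ := fun z => quadPoly 0 1 (π *ᵥ (z.1 - z₀.1)) with hΘ
  have hφc : Continuous φ := (continuous_quadPoly _ _).comp (by fun_prop)
  have hΘc : Continuous Θ := (continuous_quadPoly _ _).comp (by fun_prop)
  have hfz₀ : f z₀ = r := by rw [← hr, hg]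
  obtain ⟨ε, hε, hball⟩ := Metric.eventually_nhds_iff.1 hc.2
  -- The ball must lie in `U`, and its image under `R` must stay where the contact inequality for
  -- `g` holds.
  obtain ⟨ρ, hρ, hρW⟩ : ∃ ρ > 0, Metric.closedBall z₀.1 ρ ⊆
      U ∩ {z | dist (x.1 + R *ᵥ (z - z₀.1)) x.1 < ε} := by
    refine Metric.nhds_basis_closedBall.mem_iff.1 (inter_mem (hU.mem_nhds z₀.2) ?_)
    refine IsOpen.mem_nhds (isOpen_lt (by fun_prop) (by fun_prop)) ?_
    simpa using hε
  set S : Set U := {z | z.1 ∈ Metric.closedBall z₀.1 ρ} with hS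
  have hSc : IsCompact S := by
    rw [Subtype.isCompact_iff]
    have : Subtype.val '' S = Metric.closedBall z₀.1 ρ := Set.ext fun z =>
      ⟨fun ⟨w, hw, hwz⟩ => hwz ▸ hw, fun hz => ⟨⟨z, (hρW hz).1⟩, hz, rfl⟩⟩
    rw [this]
    exact isCompact_closedBall z₀.1 ρ
  have hSn : S ∈ 𝓝 z₀ :=
    continuous_subtype_val.continuousAt.preimage_mem_nhds (Metric.closedBall_mem_nhds _ hρ)
  obtain ⟨k, z, t, -, hzt, hmax, hz, ht⟩ := exists_penalized_maxima hSc hf hφc hΘc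
    (z₀ := z₀) (r := r) (fun z => by simp [hΘ, quadPoly,
      Finset.sum_nonneg, dotProduct, mul_self_nonneg]) (mem_of_mem_nhds hSn) hfz₀
    (by simp [hφ, quadPoly]) (by simp [hΘ, quadPoly]) (by
      -- With `Θ z = 0` the point is `c + L (x + w)`, so the contact inequality for `g` applies; the
      -- extra `δ / 2 * |w|²` then forces `w = 0`.
      intro z hzS hΘz hrz
      have h0 : π *ᵥ (z.1 - z₀.1) = 0 := by
        have : (π *ᵥ (z.1 - z₀.1)) ⬝ᵥ (π *ᵥ (z.1 - z₀.1)) = 0 := by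
          simpa [hΘ, quadPoly] using hΘz
        exact dotProduct_self_eq_zero.1 this
      set w := R *ᵥ (z.1 - z₀.1) with hw
      have hLw : z.1 = c + L *ᵥ (x.1 + w) := by
        rw [hπ, sub_mulVec, one_mulVec, sub_eq_zero, ← mulVec_mulVec, ← hw] at h0
        rw [mulVec_add, ← h0, ← add_assoc]
        exact (add_sub_cancel z₀.1 z.1).symm
      have hyV : x.1 + w ∈ V := (hVU _).2 (hLw ▸ z.2)
      have h1 := hball (y := ⟨x.1 + w, hyV⟩) (hρW hzS).2
      have h2 : g ⟨x.1 + w, hyV⟩ = f z := by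
        rw [hg]; congr 1; exact Subtype.ext hLw.symm
      rw [h2, hr] at h1
      have h3 := hrz.trans h1
      rw [← WithBot.coe_add, WithBot.coe_le_coe] at h3
      have h4 : quadPoly p A' w = quadPoly p A.1 w + δ / 2 * (w ⬝ᵥ w) := by
        simp only [quadPoly, hA', add_mulVec, smul_mulVec, one_mulVec, dotProduct_add,
          dotProduct_smul, smul_eq_mul]
        ring
      have h5 : r + quadPoly p A' w ≤ r + quadPoly p A.1 w := by
        simp only [add_sub_cancel_left] at h3
        exact h3
      have h6 : w ⬝ᵥ w ≤ 0 := by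
        by_contra hcon
        have := mul_pos (half_pos hδ) (not_le.1 hcon)
        linarith
      have h7 : w = 0 := by
        refine dotProduct_self_eq_zero.1 (le_antisymm h6 ?_)
        exact Finset.sum_nonneg fun i _ => mul_self_nonneg _
      refine Subtype.ext ?_
      rw [hLw, h7, add_zero])
  set q : ν → ℝ := Rᴴ *ᵥ p with hq
  set B : ℕ → Matrix ν ν ℝ := fun k => Rᴴ * A' * R + (k : ℝ) • (πᴴ * π) with hB
  have hBh : ∀ k, (B k).IsHermitian := fun k =>
    (isHermitian_conjTranspose_mul_mul R (hherm δ)).add (by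
      simp [IsHermitian])
  have hΨ : ∀ (j : ℕ) (y : U),
      φ y + k j * Θ y = quadPoly q (B (k j)) (y.1 - z₀.1) := by
    intro j y
    simp only [hφ, hΘ, quadPoly_mulVec]
    simp only [quadPoly, hB, hq, add_mulVec, smul_mulVec, dotProduct_add, dotProduct_smul,
      smul_eq_mul, mulVec_zero, zero_dotProduct, Matrix.mul_one]
    ring
  have hjet : ∀ᶠ j in atTop,
      (t j, p + A' *ᵥ (R *ᵥ ((z j).1 - z₀.1)), (⟨A', hherm δ⟩ : HermMat ℝ ι)) ∈ K := by
    filter_upwards [hz.eventually (eventually_mem_nhds_iff.2 hSn)] with j hj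
    -- The unbounded coefficient `k j` disappears here, since `π * L = 0`.
    have hLB : Lᴴ * B (k j) = A' * R := by
      have h1 : Lᴴ * Rᴴ = 1 := by rw [← conjTranspose_mul, hRL, conjTranspose_one]
      have h2 : Lᴴ * πᴴ = 0 := by rw [← conjTranspose_mul, hπL, conjTranspose_zero]
      simp only [hB, Matrix.mul_add, Matrix.mul_smul, ← Matrix.mul_assoc, h1, h2]
      simp
    -- `S` is a neighbourhood of `z j`, so maximality on `S` is upper contact; the gradient is that
    -- of the penalized polynomial recentred at `z j`.
    have := hfK (z j) (t j, q + B (k j) *ᵥ ((z j).1 - z₀.1), ⟨B (k j), hBh _⟩) (hzt j) (by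
      refine ⟨by rw [hzt]; exact WithBot.coe_ne_bot, ?_⟩
      filter_upwards [hj] with y hy
      refine (hmax j y hy).trans_eq ?_
      rw [hzt, hΨ, hΨ, quadPoly_sub _ (hBh _), sub_sub_sub_cancel_right, WithBot.coe_add]
      rfl)
    convert this using 1
    refine Prod.ext rfl (Prod.ext ?_ (Subtype.ext ?_))
    · simp only [pullJet, mulVec_add, mulVec_mulVec, hLB, hq]
      rw [← conjTranspose_mul, hRL, conjTranspose_one, one_mulVec]
    · simp only [pullJet, hLB]
      rw [Matrix.mul_assoc, hRL, Matrix.mul_one]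
  refine hK.mem_of_tendsto (ht.prodMk_nhds (Tendsto.prodMk_nhds ?_ tendsto_const_nhds)) hjet
  have hcont : Continuous fun z : U => p + A' *ᵥ (R *ᵥ (z.1 - z₀.1)) := by fun_prop
  simpa [Function.comp_def] using (hcont.tendsto z₀).comp hz

/-- In `hHF` any base point `x` will do: constant coefficients transfer membership to the fibre over
the contact point. -/
theorem IsSubharmonic.comp_affine {ι ν : Type*} [Fintype ι] [Fintype ν] [DecidableEq ι]
    [DecidableEq ν] {Z U : Set (ν → ℝ)} {X V : Set (ι → ℝ)} {H : Set (JetBundle Z)}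
    {F : Set (JetBundle X)} (hF : IsClosed F) (hFc : IsConstantCoefficient F) {hUZ : U ⊆ Z}
    {f : U → WithBot ℝ} (hf : IsSubharmonic H hUZ f) (hU : IsOpen U) {hVX : V ⊆ X}
    {g : V → WithBot ℝ} {L : Matrix ν ι ℝ} {R : Matrix ι ν ℝ} (hRL : R * L = 1) (c : ν → ℝ)
    (hVU : ∀ x, x ∈ V ↔ c + L *ᵥ x ∈ U)
    (hg : ∀ x : V, g x = f ⟨c + L *ᵥ x.1, (hVU _).1 x.2⟩)
    (hHF : ∀ (z : Z) (α : Jet ℝ ν), α ∈ jetFibre H z → ∃ x : X, pullJet L α ∈ jetFibre F x) :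
    IsSubharmonic F hVX g := by
  refine ⟨?_, fun x r p A hr hc => ?_⟩
  · have hcont : Continuous fun x : V => (⟨c + L *ᵥ x.1, (hVU _).1 x.2⟩ : U) := by fun_prop
    rw [funext hg]
    exact hf.1.comp hcont
  · refine hc.mem_of_forall_pullJet_mem (f := f) hU hf.1 hRL c hVU hg
      (hF.preimage (Continuous.prodMk_right (⟨x.1, hVX x.2⟩ : X))) (fun z α hα hc => ?_) hr
    obtain ⟨x', hx'⟩ := hHF _ _ (hf.2 z α.1 α.2.1 α.2.2 hα hc)
    exact (hFc _ _ _).1 hx'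

theorem IsSubharmonic.pullJet_mem {ι ν : Type*} [Fintype ι] [Fintype ν] {U : Set (ν → ℝ)}
    {X V : Set (ι → ℝ)} {F : Set (JetBundle X)} {f : U → WithBot ℝ} {hVX : V ⊆ X}
    {g : V → WithBot ℝ} (hgF : IsSubharmonic F hVX g) {L : Matrix ν ι ℝ} (c : ν → ℝ)
    (hVU : ∀ x, x ∈ V ↔ c + L *ᵥ x ∈ U)
    (hg : ∀ x : V, g x = f ⟨c + L *ᵥ x.1, (hVU _).1 x.2⟩) {z : U} {x : ι → ℝ}
    (hz : z.1 = c + L *ᵥ x) {α : Jet ℝ ν} (hα : f z = α.1)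
    (hc : IsUpperContactJet f z α.2.1 α.2.2) :
    pullJet L α ∈ jetFibre F ⟨x, hVX ((hVU x).2 (hz ▸ z.2))⟩ := by
  obtain ⟨z, hzU⟩ := z
  dsimp only at hz
  subst hz
  exact hgF.2 ⟨x, (hVU x).2 hzU⟩ _ _ _ (by rw [hg]; exact hα)
    (IsUpperContactJet.comp_affine L c (fun x hx => (hVU x).1 hx) hg hc)

/-! ### Slices as affine embeddings -/

theorem pullNonvertical_eq_pullJet {𝕜 : Type*} [RCLike 𝕜] {ι κ : Type*} [Fintype ι] [Fintype κ]
    [DecidableEq ι] (Γ : Matrix κ ι 𝕜) (α : Jet 𝕜 (ι ⊕ κ)) :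
    pullNonvertical Γ α = pullJet (fromRows 1 Γ) α := by
  obtain ⟨r, p, A, hA⟩ := α
  have hC : A.toBlocks₂₁ = A.toBlocks₁₂ᴴ := by
    rw [← fromBlocks_toBlocks A, isHermitian_fromBlocks_iff] at hA
    exact hA.2.1.symm
  refine Prod.ext rfl (Prod.ext ?_ (Subtype.ext ?_))
  · simp only [pullNonvertical, pullJet, conjTranspose_fromRows_eq_fromCols_conjTranspose]
    rw [fromCols_mulVec]
    simp [Function.comp_def]
  · simp only [pullNonvertical, pullJet, conjTranspose_fromRows_eq_fromCols_conjTranspose]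
    conv_rhs => rw [← fromBlocks_toBlocks A]
    rw [fromCols_mul_fromBlocks, fromCols_mul_fromRows, hC]
    simp only [conjTranspose_one, Matrix.one_mul, Matrix.mul_one, Matrix.add_mul]
    abel

theorem pullVertical_eq_pullJet {𝕜 : Type*} [RCLike 𝕜] {ι κ : Type*} [Fintype ι] [Fintype κ]
    [DecidableEq κ] (α : Jet 𝕜 (ι ⊕ κ)) :
    pullVertical α = pullJet (fromRows 0 1) α := by
  obtain ⟨r, p, A, hA⟩ := α
  refine Prod.ext rfl (Prod.ext ?_ (Subtype.ext ?_))
  · simp only [pullVertical, pullJet, conjTranspose_fromRows_eq_fromCols_conjTranspose]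
    rw [fromCols_mulVec]
    simp [Function.comp_def]
  · simp only [pullVertical, pullJet, conjTranspose_fromRows_eq_fromCols_conjTranspose]
    conv_rhs => rw [← fromBlocks_toBlocks A]
    rw [fromCols_mul_fromBlocks, fromCols_mul_fromRows]
    simp

theorem nonverticalSlice_eq {𝕜 : Type*} [RCLike 𝕜] {ι κ : Type*} [Fintype ι] [DecidableEq ι]
    (y₀ : κ → 𝕜) (Γ : Matrix κ ι 𝕜) (x : ι → 𝕜) :
    nonverticalSlice y₀ Γ x = Sum.elim (0 : ι → 𝕜) y₀ + fromRows 1 Γ *ᵥ x := by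
  rw [fromRows_mulVec, one_mulVec]
  ext i
  cases i <;> simp [nonverticalSlice]

theorem verticalSlice_eq {𝕜 : Type*} [RCLike 𝕜] {ι κ : Type*} [Fintype κ] [DecidableEq κ]
    (x₀ : ι → 𝕜) (y : κ → 𝕜) :
    verticalSlice x₀ y = Sum.elim x₀ (0 : κ → 𝕜) + fromRows 0 1 *ᵥ y := by
  rw [fromRows_mulVec, one_mulVec]
  ext i
  cases i <;> simp [verticalSlice]

/-- For each slope `Γ`, this choice of `y₀` makes the slice pass through `z`. -/
theorem nonverticalSlice_apply_self {𝕜 : Type*} [RCLike 𝕜] {ι κ : Type*} [Fintype ι]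
    (Γ : Matrix κ ι 𝕜) (z : ι ⊕ κ → 𝕜) :
    nonverticalSlice ((fun k => z (Sum.inr k)) - Γ *ᵥ fun i => z (Sum.inl i)) Γ
      (fun i => z (Sum.inl i)) = z := by
  ext i
  cases i <;> simp [nonverticalSlice]

theorem verticalSlice_apply_self {𝕜 : Type*} {ι κ : Type*} (z : ι ⊕ κ → 𝕜) :
    verticalSlice (fun i => z (Sum.inl i)) (fun k => z (Sum.inr k)) = z := by
  ext i
  cases i <;> rfl

/-! ### Complex linear maps and complex jets in real coordinates -/

/-- The real matrix of the complex linear map with matrix `M`. -/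
def realify {a b : Type*} (M : Matrix a b ℂ) : Matrix (a ⊕ a) (b ⊕ b) ℝ :=
  fromBlocks (M.map Complex.re) (-M.map Complex.im) (M.map Complex.im) (M.map Complex.re)

/-- The matrix of the complex linear part of the real linear map with matrix `A`. -/
noncomputable def complexify {a b : Type*} (A : Matrix (a ⊕ a) (b ⊕ b) ℝ) : Matrix a b ℂ :=
  Matrix.of fun i j => ⟨1 / 2 * (A (Sum.inl i) (Sum.inl j) + A (Sum.inr i) (Sum.inr j)),
    1 / 2 * (A (Sum.inr i) (Sum.inl j) - A (Sum.inl i) (Sum.inr j))⟩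

theorem hatMat_complexPart {ι : Type*} [Fintype ι] [DecidableEq ι]
    (A : Matrix (ι ⊕ ι) (ι ⊕ ι) ℝ) : hatMat (complexPart A) = complexify A :=
  Matrix.ext fun i j => hatMat_complexPart_apply A i j

/-- Composing with a complex linear map preserves the splitting into complex linear and antilinear
parts, so the projection to the linear part commutes with it. -/
theorem complexify_realify_mul {a b d : Type*} [Fintype b] (M : Matrix a b ℂ)
    (A : Matrix (b ⊕ b) (d ⊕ d) ℝ) : complexify (realify M * A) = M * complexify A := by
  ext i j
  apply Complex.ext <;>
  · simp only [complexify, realify, of_apply, mul_apply, Fintype.sum_sum_type, fromBlocks_apply₁₁,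
      fromBlocks_apply₁₂, fromBlocks_apply₂₁, fromBlocks_apply₂₂, map_apply, Matrix.neg_apply,
      Complex.re_sum, Complex.im_sum, Complex.mul_re, Complex.mul_im, ← Finset.sum_add_distrib,
      ← Finset.sum_sub_distrib, Finset.mul_sum]
    exact Finset.sum_congr rfl fun k _ => by ring

theorem complexify_mul_realify {a b d : Type*} [Fintype b] (A : Matrix (a ⊕ a) (b ⊕ b) ℝ)
    (M : Matrix b d ℂ) : complexify (A * realify M) = complexify A * M := by
  ext i j
  apply Complex.ext <;>
  · simp only [complexify, realify, of_apply, mul_apply, Fintype.sum_sum_type, fromBlocks_apply₁₁,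
      fromBlocks_apply₁₂, fromBlocks_apply₂₁, fromBlocks_apply₂₂, map_apply, Matrix.neg_apply,
      Complex.re_sum, Complex.im_sum, Complex.mul_re, Complex.mul_im, ← Finset.sum_add_distrib,
      ← Finset.sum_sub_distrib, Finset.mul_sum]
    exact Finset.sum_congr rfl fun k _ => by ring

theorem realify_mul {a b d : Type*} [Fintype b] (M : Matrix a b ℂ) (N : Matrix b d ℂ) :
    realify (M * N) = realify M * realify N := by
  simp only [realify, fromBlocks_multiply]
  congr 1 <;> ext i j <;>
    simp [mul_apply, Complex.re_sum, Complex.im_sum, Finset.sum_add_distrib, ← sub_eq_add_neg,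
      add_comm]

theorem realify_one {a : Type*} [DecidableEq a] : realify (1 : Matrix a a ℂ) = 1 := by
  rw [← fromBlocks_one, realify]
  congr 1 <;> ext i j <;> by_cases h : i = j <;> simp [h, one_apply]

theorem conjTranspose_realify {a b : Type*} (M : Matrix a b ℂ) :
    (realify M)ᴴ = realify Mᴴ := by
  rw [realify, realify, fromBlocks_conjTranspose]
  congr 1
  all_goals ext i j; simp

theorem toComplexVec_add {a : Type*} (v w : a ⊕ a → ℝ) :
    toComplexVec (v + w) = toComplexVec v + toComplexVec w := rfl

theorem toComplexVec_mulVec {a b : Type*} [Fintype b] (M : Matrix a b ℂ) (v : b ⊕ b → ℝ) :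
    toComplexVec (realify M *ᵥ v) = M *ᵥ toComplexVec v := by
  ext i
  apply Complex.ext <;>
  · simp only [toComplexVec, realify, mulVec, dotProduct, Fintype.sum_sum_type, fromBlocks_apply₁₁,
      fromBlocks_apply₁₂, fromBlocks_apply₂₁, fromBlocks_apply₂₂, map_apply, Matrix.neg_apply,
      Complex.re_sum, Complex.im_sum, Complex.mul_re, Complex.mul_im, ← Finset.sum_add_distrib]
    exact Finset.sum_congr rfl fun k _ => by ring

/-- The identification `ℂⁿ ≃ ℝ²ⁿ`, inverse to `toComplexVec`. -/
def ofComplexVec {a : Type*} (c : a → ℂ) : a ⊕ a → ℝ :=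
  Sum.elim (fun i => (c i).re) (fun i => (c i).im)

theorem toComplexVec_ofComplexVec {a : Type*} (c : a → ℂ) : toComplexVec (ofComplexVec c) = c := rfl

theorem ofComplexVec_toComplexVec {a : Type*} (v : a ⊕ a → ℝ) :
    ofComplexVec (toComplexVec v) = v := by
  ext i
  cases i <;> rfl

theorem toComplexVec_injective {a : Type*} :
    Function.Injective (toComplexVec : (a ⊕ a → ℝ) → a → ℂ) :=
  Function.LeftInverse.injective ofComplexVec_toComplexVec

theorem toComplexVec_affine {a b : Type*} [Fintype b] (c : a → ℂ) (M : Matrix a b ℂ)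
    (v : b ⊕ b → ℝ) :
    toComplexVec (ofComplexVec c + realify M *ᵥ v) = c + M *ᵥ toComplexVec v := by
  rw [toComplexVec_add, toComplexVec_ofComplexVec, toComplexVec_mulVec]

theorem continuous_toComplexVec {a : Type*} :
    Continuous (toComplexVec : (a ⊕ a → ℝ) → a → ℂ) := by
  refine continuous_pi fun i => ?_
  have h : Continuous fun v : a ⊕ a → ℝ => (v (Sum.inl i), v (Sum.inr i)) := by fun_prop
  exact Complex.equivRealProdCLM.symm.continuous.comp h

theorem continuous_hatMat_complexPart {a : Type*} [Fintype a] [DecidableEq a] :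
    Continuous fun A : Matrix (a ⊕ a) (a ⊕ a) ℝ => hatMat (complexPart A) := by
  refine continuous_pi fun i => continuous_pi fun j => ?_
  have h : Continuous fun A : Matrix (a ⊕ a) (a ⊕ a) ℝ => complexPart A := by
    unfold complexPart
    fun_prop
  exact Complex.equivRealProdCLM.symm.continuous.comp
    ((h.matrix_elem (Sum.inl i) (Sum.inl j)).prodMk (h.matrix_elem (Sum.inr i) (Sum.inl j)))

/-- The complex jet of a real jet on `ℂⁿ = ℝ²ⁿ`. -/
noncomputable def complexJet {ι : Type*} [Fintype ι] [DecidableEq ι] (α : Jet ℝ (ι ⊕ ι)) :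
    Jet ℂ ι :=
  (α.1, toComplexVec α.2.1, ⟨hatMat (complexPart α.2.2.1), hatMat_complexPart_isHermitian α.2.2⟩)

theorem continuous_complexJet {ι : Type*} [Fintype ι] [DecidableEq ι] :
    Continuous (complexJet : Jet ℝ (ι ⊕ ι) → Jet ℂ ι) :=
  continuous_fst.prodMk ((continuous_toComplexVec.comp (continuous_fst.comp continuous_snd)).prodMk
    ((continuous_hatMat_complexPart.comp
      (continuous_subtype_val.comp (continuous_snd.comp continuous_snd))).subtype_mk _))

/-- The real transpose of `realify M` is `realify Mᴴ`, and taking the complex linear part of a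
Hessian commutes with multiplication by such matrices on either side. This is what reduces the
complex case to real affine maps. -/
theorem complexJet_pullJet {ι ν : Type*} [Fintype ι] [DecidableEq ι] [Fintype ν] [DecidableEq ν]
    (M : Matrix ν ι ℂ) (α : Jet ℝ (ν ⊕ ν)) :
    complexJet (pullJet (realify M) α) = pullJet M (complexJet α) := by
  refine Prod.ext rfl (Prod.ext ?_ (Subtype.ext ?_))
  · simp only [complexJet, pullJet, conjTranspose_realify, toComplexVec_mulVec]
  · simp only [complexJet, pullJet, conjTranspose_realify, hatMat_complexPart,
      complexify_mul_realify, complexify_realify_mul]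

theorem isClosed_realModel {ι : Type*} [Fintype ι] [DecidableEq ι] {X : Set (ι → ℂ)}
    {F : Set (JetBundle X)} (hF : IsClosed F) : IsClosed (realModel F) := by
  have h : Continuous fun a : JetBundle (toComplexVec ⁻¹' X) =>
      ((⟨toComplexVec a.1.1, a.1.2⟩ : X), complexJet a.2) :=
    ((continuous_toComplexVec.comp (continuous_subtype_val.comp continuous_fst)).subtype_mk
      _).prodMk (continuous_complexJet.comp continuous_snd)
  exact hF.preimage h

theorem IsConstantCoefficient.realModel {ι : Type*} [Fintype ι] [DecidableEq ι] {X : Set (ι → ℂ)}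
    {F : Set (JetBundle X)} (hF : IsConstantCoefficient F) :
    IsConstantCoefficient (realModel F) :=
  fun x x' α => hF ⟨toComplexVec x.1, x.2⟩ ⟨toComplexVec x'.1, x'.2⟩ (complexJet α)

theorem fromCols_one_zero_mul_fromRows {𝕜 : Type*} [RCLike 𝕜] {ι κ : Type*} [Fintype ι] [Fintype κ]
    [DecidableEq ι] (Γ : Matrix κ ι 𝕜) :
    fromCols (1 : Matrix ι ι 𝕜) (0 : Matrix ι κ 𝕜) * fromRows (1 : Matrix ι ι 𝕜) Γ = 1 := by
  rw [fromCols_mul_fromRows]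
  simp

theorem fromCols_zero_one_mul_fromRows {𝕜 : Type*} [RCLike 𝕜] {ι κ : Type*} [Fintype ι]
    [Fintype κ] [DecidableEq κ] :
    fromCols (0 : Matrix κ ι 𝕜) (1 : Matrix κ κ 𝕜) *
      fromRows (0 : Matrix ι κ 𝕜) (1 : Matrix κ κ 𝕜) = 1 := by
  rw [fromCols_mul_fromRows]
  simp

theorem mem_jetFibre_realModel {ι : Type*} [Fintype ι] [DecidableEq ι] {X : Set (ι → ℂ)}
    {F : Set (JetBundle X)} (x : (toComplexVec ⁻¹' X : Set (ι ⊕ ι → ℝ))) (α : Jet ℝ (ι ⊕ ι)) :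
    α ∈ jetFibre (realModel F) x ↔ complexJet α ∈ jetFibre F ⟨toComplexVec x.1, x.2⟩ :=
  Iff.rfl

/-! ### The equivalence over `ℝ` and over `ℂ` -/

theorem isSubharmonic_prodSubequation_iff {ι κ : Type*} [Fintype ι] [Fintype κ] [DecidableEq ι]
    [DecidableEq κ] {X : Set (ι → ℝ)} {Y : Set (κ → ℝ)} {F : Set (JetBundle X)}
    {G : Set (JetBundle Y)} (hF : IsClosed F) (hFc : IsConstantCoefficient F) (hG : IsClosed G)
    (hGc : IsConstantCoefficient G) {Ω : Set (ι ⊕ κ → ℝ)} (hΩ : Ω ⊆ prodDomain X Y)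
    (hΩo : IsOpen Ω) {f : Ω → WithBot ℝ} (hf : UpperSemicontinuous f) :
    IsSubharmonic (prodSubequation F G) hΩ f ↔
      (∀ (y₀ : κ → ℝ) (Γ : Matrix κ ι ℝ),
        IsSubharmonic F (nonverticalSlice_preimage_subset hΩ y₀ Γ)
          (pullbackFun (nonverticalSlice y₀ Γ) f)) ∧
      (∀ x₀ ∈ X, IsSubharmonic G (verticalSlice_preimage_subset hΩ x₀)
          (pullbackFun (verticalSlice x₀) f)) := by
  have hn : ∀ (y₀ : κ → ℝ) (Γ : Matrix κ ι ℝ) (x : ι → ℝ), x ∈ nonverticalSlice y₀ Γ ⁻¹' Ω ↔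
      Sum.elim (0 : ι → ℝ) y₀ + fromRows 1 Γ *ᵥ x ∈ Ω := fun y₀ Γ x => by
    rw [← nonverticalSlice_eq]; rfl
  have hv : ∀ (x₀ : ι → ℝ) (y : κ → ℝ), y ∈ verticalSlice x₀ ⁻¹' Ω ↔
      Sum.elim x₀ (0 : κ → ℝ) + fromRows 0 1 *ᵥ y ∈ Ω := fun x₀ y => by
    rw [← verticalSlice_eq]; rfl
  refine ⟨fun h => ⟨fun y₀ Γ => ?_, fun x₀ _ => ?_⟩, fun h => ⟨hf, fun z r p A hr hc => ?_⟩⟩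
  · refine h.comp_affine hF hFc hΩo (fromCols_one_zero_mul_fromRows Γ) _ (hn y₀ Γ)
      (fun x => congrArg f (Subtype.ext (nonverticalSlice_eq y₀ Γ x.1))) fun z α hα => ?_
    rw [← pullNonvertical_eq_pullJet]
    exact ⟨_, (hα Γ).1⟩
  · refine h.comp_affine hG hGc hΩo fromCols_zero_one_mul_fromRows _ (hv x₀)
      (fun x => congrArg f (Subtype.ext (verticalSlice_eq x₀ x.1))) fun z α hα => ?_
    rw [← pullVertical_eq_pullJet]
    -- The condition on `G` does not involve `Γ`, so any value, here `0`, extracts it.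
    exact ⟨_, (hα 0).2⟩
  · refine fun Γ => ⟨?_, ?_⟩
    · rw [pullNonvertical_eq_pullJet]
      exact (h.1 _ Γ).pullJet_mem _ (hn _ Γ)
        (fun x => congrArg f (Subtype.ext (nonverticalSlice_eq _ Γ x.1)))
        (((nonverticalSlice_apply_self Γ z.1).symm).trans (nonverticalSlice_eq _ Γ _)) hr hc
    · rw [pullVertical_eq_pullJet]
      exact (h.2 _ (hΩ z.2).1).pullJet_mem _ (hv _)
        (fun x => congrArg f (Subtype.ext (verticalSlice_eq _ x.1)))
        (((verticalSlice_apply_self z.1).symm).trans (verticalSlice_eq _ _)) hr hc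

/-- Not an instance of the real equivalence, since only complex linear `Γ` occur; the affine lemmas
are applied directly to the realified slices. -/
theorem isComplexSubharmonic_prodSubequation_iff {ι κ : Type*} [Fintype ι] [Fintype κ]
    [DecidableEq ι] [DecidableEq κ] {X : Set (ι → ℂ)} {Y : Set (κ → ℂ)} {F : Set (JetBundle X)}
    {G : Set (JetBundle Y)} (hF : IsClosed F) (hFc : IsConstantCoefficient F) (hG : IsClosed G)
    (hGc : IsConstantCoefficient G) {Ω : Set (ι ⊕ κ → ℂ)} (hΩ : Ω ⊆ prodDomain X Y)
    (hΩo : IsOpen Ω) {f : Ω → WithBot ℝ} (hf : UpperSemicontinuous f) :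
    IsComplexSubharmonic (prodSubequation F G) hΩ f ↔
      (∀ (y₀ : κ → ℂ) (Γ : Matrix κ ι ℂ),
        IsComplexSubharmonic F (nonverticalSlice_preimage_subset hΩ y₀ Γ)
          (pullbackFun (nonverticalSlice y₀ Γ) f)) ∧
      (∀ x₀ ∈ X, IsComplexSubharmonic G (verticalSlice_preimage_subset hΩ x₀)
          (pullbackFun (verticalSlice x₀) f)) := by
  let f' : (toComplexVec ⁻¹' Ω : Set ((ι ⊕ κ) ⊕ (ι ⊕ κ) → ℝ)) → WithBot ℝ :=
    fun v => f ⟨toComplexVec v.1, v.2⟩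
  have hΩo' : IsOpen (toComplexVec ⁻¹' Ω : Set ((ι ⊕ κ) ⊕ (ι ⊕ κ) → ℝ)) :=
    hΩo.preimage continuous_toComplexVec
  have hne : ∀ (y₀ : κ → ℂ) (Γ : Matrix κ ι ℂ) (x : ι ⊕ ι → ℝ),
      nonverticalSlice y₀ Γ (toComplexVec x) = toComplexVec
        (ofComplexVec (Sum.elim (0 : ι → ℂ) y₀) + realify (fromRows 1 Γ) *ᵥ x) :=
    fun y₀ Γ x => by rw [toComplexVec_affine, nonverticalSlice_eq]
  have hve : ∀ (x₀ : ι → ℂ) (y : κ ⊕ κ → ℝ), verticalSlice x₀ (toComplexVec y) = toComplexVec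
      (ofComplexVec (Sum.elim x₀ (0 : κ → ℂ)) + realify (fromRows 0 1) *ᵥ y) :=
    fun x₀ y => by rw [toComplexVec_affine, verticalSlice_eq]
  have hn : ∀ (y₀ : κ → ℂ) (Γ : Matrix κ ι ℂ) (x : ι ⊕ ι → ℝ),
      x ∈ (toComplexVec ⁻¹' (nonverticalSlice y₀ Γ ⁻¹' Ω) : Set (ι ⊕ ι → ℝ)) ↔
      ofComplexVec (Sum.elim (0 : ι → ℂ) y₀) + realify (fromRows 1 Γ) *ᵥ x ∈
        (toComplexVec ⁻¹' Ω : Set ((ι ⊕ κ) ⊕ (ι ⊕ κ) → ℝ)) := fun y₀ Γ x => by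
    rw [Set.mem_preimage, Set.mem_preimage, hne]; rfl
  have hv : ∀ (x₀ : ι → ℂ) (y : κ ⊕ κ → ℝ),
      y ∈ (toComplexVec ⁻¹' (verticalSlice x₀ ⁻¹' Ω) : Set (κ ⊕ κ → ℝ)) ↔
      ofComplexVec (Sum.elim x₀ (0 : κ → ℂ)) + realify (fromRows 0 1) *ᵥ y ∈
        (toComplexVec ⁻¹' Ω : Set ((ι ⊕ κ) ⊕ (ι ⊕ κ) → ℝ)) := fun x₀ y => by
    rw [Set.mem_preimage, Set.mem_preimage, hve]; rfl
  refine ⟨fun h => ⟨fun y₀ Γ => ?_, fun x₀ _ => ?_⟩, fun h => ⟨?_, fun z r p A hr hc => ?_⟩⟩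
  · refine IsSubharmonic.comp_affine (isClosed_realModel hF) hFc.realModel h hΩo'
      (f := f') (R := realify (fromCols 1 0)) (L := realify (fromRows 1 Γ))
      (by rw [← realify_mul, fromCols_one_zero_mul_fromRows, realify_one]) _ (hn y₀ Γ)
      (fun x => congrArg f (Subtype.ext (hne y₀ Γ x.1)))
      fun z α hα => ?_
    have h1 := (hα Γ).1
    refine ⟨⟨ofComplexVec fun i => toComplexVec z.1 (Sum.inl i), z.2.1⟩, ?_⟩
    rw [pullNonvertical_eq_pullJet] at h1
    rw [mem_jetFibre_realModel, complexJet_pullJet]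
    exact h1
  · refine IsSubharmonic.comp_affine (isClosed_realModel hG) hGc.realModel h hΩo'
      (f := f') (R := realify (fromCols 0 1)) (L := realify (fromRows 0 1))
      (by rw [← realify_mul, fromCols_zero_one_mul_fromRows, realify_one]) _ (hv x₀)
      (fun x => congrArg f (Subtype.ext (hve x₀ x.1)))
      fun z α hα => ?_
    have h1 := (hα 0).2
    refine ⟨⟨ofComplexVec fun k => toComplexVec z.1 (Sum.inr k), z.2.2⟩, ?_⟩
    rw [pullVertical_eq_pullJet] at h1
    rw [mem_jetFibre_realModel, complexJet_pullJet]
    exact h1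
  · exact hf.comp ((continuous_toComplexVec.comp continuous_subtype_val).subtype_mk _)
  · refine fun Γ => ⟨?_, ?_⟩
    -- The slice through the point is found in complex coordinates; injectivity brings the identity
    -- back to real ones.
    · have hz : z.1 = _ := toComplexVec_injective
        ((nonverticalSlice_apply_self Γ (toComplexVec z.1)).symm.trans
          (hne _ Γ (ofComplexVec fun i => toComplexVec z.1 (Sum.inl i))))
      have := IsSubharmonic.pullJet_mem (α := (r, p, A)) (f := f') (h.1 _ Γ) _ (hn _ Γ)
        (fun x => congrArg f (Subtype.ext (hne _ Γ x.1))) hz hr hc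
      rw [mem_jetFibre_realModel, complexJet_pullJet, ← pullNonvertical_eq_pullJet] at this
      exact this
    · have hz : z.1 = _ := toComplexVec_injective
        ((verticalSlice_apply_self (toComplexVec z.1)).symm.trans
          (hve _ (ofComplexVec fun k => toComplexVec z.1 (Sum.inr k))))
      have := IsSubharmonic.pullJet_mem (α := (r, p, A)) (f := f') (h.2 _ (hΩ z.2).1) _ (hv _)
        (fun x => congrArg f (Subtype.ext (hve _ x.1))) hz hr hc
      rw [mem_jetFibre_realModel, complexJet_pullJet, ← pullVertical_eq_pullJet] at this
      exact this

theorem mainTheorem3 (n m : ℕ) :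
    (∀ (X : Set (Fin n → ℝ)) (Y : Set (Fin m → ℝ)), IsOpen X → IsOpen Y →
      ∀ (F : Set (JetBundle X)) (G : Set (JetBundle Y)),
        IsPrimitiveSubequation F → IsConstantCoefficient F →
        IsPrimitiveSubequation G → IsConstantCoefficient G →
      ∀ (Ω : Set (Fin n ⊕ Fin m → ℝ)) (hΩ : Ω ⊆ prodDomain X Y), IsOpen Ω →
      ∀ f : Ω → WithBot ℝ, UpperSemicontinuous f →
        (IsSubharmonic (prodSubequation F G) hΩ f ↔
          (∀ (y₀ : Fin m → ℝ) (Γ : Matrix (Fin m) (Fin n) ℝ),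
            IsSubharmonic F (nonverticalSlice_preimage_subset hΩ y₀ Γ)
              (pullbackFun (nonverticalSlice y₀ Γ) f)) ∧
          (∀ x₀ ∈ X,
            IsSubharmonic G (verticalSlice_preimage_subset hΩ x₀)
              (pullbackFun (verticalSlice x₀) f)))) ∧
    (∀ (X : Set (Fin n → ℂ)) (Y : Set (Fin m → ℂ)), IsOpen X → IsOpen Y →
      ∀ (F : Set (JetBundle X)) (G : Set (JetBundle Y)),
        IsPrimitiveSubequation F → IsConstantCoefficient F →
        IsPrimitiveSubequation G → IsConstantCoefficient G →
      ∀ (Ω : Set (Fin n ⊕ Fin m → ℂ)) (hΩ : Ω ⊆ prodDomain X Y), IsOpen Ω →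
      ∀ f : Ω → WithBot ℝ, UpperSemicontinuous f →
        (IsComplexSubharmonic (prodSubequation F G) hΩ f ↔
          (∀ (y₀ : Fin m → ℂ) (Γ : Matrix (Fin m) (Fin n) ℂ),
            IsComplexSubharmonic F (nonverticalSlice_preimage_subset hΩ y₀ Γ)
              (pullbackFun (nonverticalSlice y₀ Γ) f)) ∧
          (∀ x₀ ∈ X,
            IsComplexSubharmonic G (verticalSlice_preimage_subset hΩ x₀)
              (pullbackFun (verticalSlice x₀) f)))) := by
  refine ⟨fun X Y _ _ F G hF hFc hG hGc Ω hΩ hΩo f hf => ?_,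
    fun X Y _ _ F G hF hFc hG hGc Ω hΩ hΩo f hf => ?_⟩
  · exact isSubharmonic_prodSubequation_iff hF.closed hFc hG.closed hGc hΩ hΩo hf
  · exact isComplexSubharmonic_prodSubequation_iff hF.closed hFc hG.closed hGc hΩ hΩo hf
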